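/- Let $k$ be a field, $F_n$ the free group on $t_1,\dots,t_n$, and $\Lambda=kF_n$ its group algebra, whose elements are called free polynomials. Let $\epsilon\colon\Lambda\to k$ be the augmentation ($t_i\mapsto 1$), and call $\delta\in\Lambda$ comonic if $\epsilon(\delta)=1$. The length $|\gamma|$ of $0\ne\gamma\in\Lambda$ is the maximal length of a reduced word occurring in $\gamma$ with nonzero coefficient. Let $L(\Lambda)$ be the Fox algebra, i.e. the universal localization of $\Lambda$ inverting the row $(x_1,\dots,x_n)=(t_1-1,\dots,t_n-1)$: the $k$-algebra generated over $\Lambda$ by $x_1^*,\dots,x_n^*$ subject to $x_i^*x_j=\delta_{ij}$ for all $i,j$ and $\sum_{i=1}^n x_ix_i^*=1$. Elements of $\Lambda$ are identified with their images in $L(\Lambda)$. Let $\gamma,\lambda\in\Lambda$ be not both zero. Then there is a comonic $\delta\in\Lambda$ with $$L(\Lambda)\gamma+L(\Lambda)\lambda=L(\Lambda)\delta$$ such that $|\delta|\le|\gamma|$ if $\gamma\ne0$ and $|\delta|\le|\lambda|$ if $\lambda\neq 0$; in particular $|\delta|\le\min\{|\gamma|,|\lambda|\}$ when both are nonzero.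 This $\delta$ is uniquely determined up to a unit: a comonic $\delta'\in\Lambda$ satisfies $L(\Lambda)\gamma+L(\Lambda)\lambda=L(\Lambda)\delta'$ if and only if $\delta'=u\delta$ for a unit $u$ of $\Lambda$. Such a $\delta$ is called a (generalized) greatest common divisor of $\gamma$ and $\lambda$. -/

import Mathlib

noncomputable section

/-- The group algebra `Λ = k F_n` of the free group of rank `n`; its elements are the
free polynomials. -/
abbrev FreePoly (k : Type*) [CommRing k] (n : ℕ) : Type _ :=
  MonoidAlgebra k (FreeGroup (Fin n))

namespace FreePoly

variable {k : Type*} [CommRing k] {n : ℕ}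

/-- The augmentation `ε : Λ → k`, the algebra map sending every group element to `1`. -/
def augmentation : FreePoly k n →ₐ[k] k :=
  MonoidAlgebra.lift k k (FreeGroup (Fin n)) 1

/-- A free polynomial is comonic if its augmentation is `1`. -/
def IsComonic (a : FreePoly k n) : Prop := augmentation a = 1

/-- The length of a free polynomial: the maximal length of a reduced word occurring in it
(the value at `0`, where no word occurs, is the conventional `0`). -/
def length (a : FreePoly k n) : ℕ := a.coeff.support.sup FreeGroup.norm

/-- The element `x_i = t_i - 1` of `Λ`. -/
def x (k : Type*) [CommRing k] {n : ℕ} (i : Fin n) : FreePoly k n :=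
  MonoidAlgebra.of k (FreeGroup (Fin n)) (FreeGroup.of i) - 1

end FreePoly

namespace FoxAlgebra

/-- The algebra obtained from `Λ` by freely adjoining `n` noncommuting indeterminates
`z_1, …, z_n`, i.e. the coproduct of the `k`-algebras `Λ` and `k⟨z_1, …, z_n⟩`, realised as the
monoid algebra of the coproduct of the free group and the free monoid. -/
abbrev Ambient (k : Type*) [CommRing k] (n : ℕ) : Type _ :=
  MonoidAlgebra k (Monoid.Coprod (FreeGroup (Fin n)) (FreeMonoid (Fin n)))

/-- The inclusion of `Λ` into `Ambient k n`. -/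
def ambientIncl (k : Type*) [CommRing k] (n : ℕ) : FreePoly k n →ₐ[k] Ambient k n :=
  MonoidAlgebra.mapDomainAlgHom k k Monoid.Coprod.inl

/-- The indeterminate `z_i`. -/
def ambientZ (k : Type*) [CommRing k] {n : ℕ} (i : Fin n) : Ambient k n :=
  MonoidAlgebra.of k _ (Monoid.Coprod.inr (FreeMonoid.of i))

/-- The relations saying that the column `(z_1, …, z_n)` is a two-sided inverse of the row
`(x_1, …, x_n)`. -/
inductive Rel (k : Type*) [CommRing k] (n : ℕ) : Ambient k n → Ambient k n → Prop
  | column_mul_row (i j : Fin n) :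
      Rel k n (ambientZ k i * ambientIncl k n (FreePoly.x k j)) (if i = j then 1 else 0)
  | row_mul_column :
      Rel k n (∑ i : Fin n, ambientIncl k n (FreePoly.x k i) * ambientZ k i) 1

end FoxAlgebra

/-- The Fox algebra `L(Λ)`: the universal localization of `Λ = k F_n` inverting the row
`(x_1, …, x_n) = (t_1 - 1, …, t_n - 1)`. -/
abbrev FoxAlgebra (k : Type*) [CommRing k] (n : ℕ) : Type _ :=
  RingQuot (FoxAlgebra.Rel k n)

namespace FoxAlgebra

/-- The canonical map `Λ → L(Λ)`. -/
def incl (k : Type*) [CommRing k] (n : ℕ) : FreePoly k n →ₐ[k] FoxAlgebra k n :=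
  (RingQuot.mkAlgHom k (Rel k n)).comp (ambientIncl k n)

/-- The entries `x_i^*` of the inverse column in `L(Λ)`. -/
def xStar (k : Type*) [CommRing k] {n : ℕ} (i : Fin n) : FoxAlgebra k n :=
  RingQuot.mkAlgHom k (Rel k n) (ambientZ k i)

variable {k : Type*} [CommRing k] {n : ℕ}

theorem xStar_mul_incl_x (i j : Fin n) :
    xStar k i * incl k n (FreePoly.x k j) = if i = j then 1 else 0 := by
  have h := RingQuot.mkAlgHom_rel k (Rel.column_mul_row (k := k) i j)
  rw [map_mul] at h
  refine h.trans ?_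
  split_ifs <;> simp

theorem sum_incl_x_mul_xStar :
    ∑ i : Fin n, incl k n (FreePoly.x k i) * xStar k i = 1 := by
  have h := RingQuot.mkAlgHom_rel k (Rel.row_mul_column (k := k) (n := n))
  rw [map_sum, map_one] at h
  simp only [map_mul] at h
  exact h

/-- The universal property of `L(Λ)`: an algebra map from `Λ` making the row
`(x_1, …, x_n)` invertible with inverse column `y` factors uniquely through `L(Λ)`. -/
theorem existsUnique_lift {B : Type*} [Ring B] [Algebra k B] (f : FreePoly k n →ₐ[k] B)
    (y : Fin n → B)
    (hyx : ∀ i j, y i * f (FreePoly.x k j) = if i = j then 1 else 0)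
    (hxy : ∑ i, f (FreePoly.x k i) * y i = 1) :
    ∃! g : FoxAlgebra k n →ₐ[k] B,
      g.comp (incl k n) = f ∧ ∀ i, g (xStar k i) = y i := by
  let p : Ambient k n →ₐ[k] B := MonoidAlgebra.lift k B _
    (Monoid.Coprod.lift ((f : FreePoly k n →* B).comp (MonoidAlgebra.of k _))
      (FreeMonoid.lift y))
  have hp : p.comp (ambientIncl k n) = f := by
    ext w
    simp [p, ambientIncl]
  have hp' : ∀ a, p (ambientIncl k n a) = f a := fun a => DFunLike.congr_fun hp a
  have hz : ∀ i, p (ambientZ k i) = y i := by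
    intro i
    simp [p, ambientZ]
  have hrel : ∀ ⦃a b⦄, Rel k n a b → p a = p b := by
    intro a b h
    cases h with
    | column_mul_row i j =>
      rw [map_mul, hz, hp', hyx]
      split_ifs <;> simp
    | row_mul_column =>
      simp only [map_sum, map_mul, hz, hp', hxy, map_one]
  refine ⟨RingQuot.liftAlgHom k ⟨p, hrel⟩, ⟨?_, ?_⟩, ?_⟩
  · apply AlgHom.ext
    intro a
    simp [incl, hp']
  · intro i
    simp [xStar, hz]
  · rintro g ⟨hg, hg'⟩
    apply RingQuot.ringQuot_ext'
    apply MonoidAlgebra.algHom_ext'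
    case single_one_left => exact Subsingleton.elim _ _
    apply Monoid.Coprod.hom_ext
    · ext i
      have := DFunLike.congr_fun hg (MonoidAlgebra.of k _ (FreeGroup.of i))
      simpa [incl, ambientIncl, p] using this
    · ext i
      have := hg' i
      simpa [xStar, ambientZ, p] using this

end FoxAlgebra

/-- `d` is a (generalized) greatest common divisor of the free polynomials `a` and `b`:
a comonic free polynomial with `L(Λ) a + L(Λ) b = L(Λ) d` (left ideals of the Fox algebra). -/
def IsFoxGCD {k : Type*} [CommRing k] {n : ℕ} (a b d : FreePoly k n) : Prop :=
  d.IsComonic ∧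
    (Ideal.span {FoxAlgebra.incl k n a} ⊔ Ideal.span {FoxAlgebra.incl k n b} :
      Ideal (FoxAlgebra k n)) = Ideal.span {FoxAlgebra.incl k n d}

end

/-! Every `z` in `Λ` is `ε(z) + ∑ x_i ∂_i z` with unique coefficients, the Fox derivatives. If `ε(z)
= 0`, then `x_i^* z = ∂_i z` in `L(Λ)`, so the trace `J` on `Λ` of any left ideal of `L(Λ)` is
closed under Fox derivatives of its elements of augmentation zero. The main point is
`IsFoxClosed.exists_generator`: over a field, such a `J ≠ 0` is `Λ d` with `d` comonic and of
minimal length in `J`. Applied to the trace of `L(Λ)γ + L(Λ)λ`, it gives existence and the length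
bounds.

The generator comes from a division argument. Writing `x_i ∂_i = t_i ∂_i - ∂_i` splits an element of
augmentation zero into letter parts. Up to shorter words these are the orthogonal projections onto
words with a given first letter, yet the parts for a letter and its inverse are unit multiples of
each other. So when the part for `s⁻¹` is short, the part for `s` is controlled by shorter elements.

For uniqueness, `L(Λ) d ∩ Λ = Λ d` when `d` is comonic (`mem_span_of_incl_mem_span`). Two generators
are thus left multiples of each other, and right cancellability of comonic elements makes the
multipliers inverse units. -/

noncomputable section

namespace FreePoly

open MonoidAlgebra (single)

/-! ### Fox calculus on the free group algebra. -/

section CommRing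

variable {k : Type*} [CommRing k] {n : ℕ}

/-- The Fox derivative of a (not necessarily reduced) word, as the signed sum of suffixes. -/
def foxWord (k : Type*) [CommRing k] {n : ℕ} (i : Fin n) : List (Fin n × Bool) → FreePoly k n
  | [] => 0
  | (j, true) :: L => foxWord k i L + if i = j then single (FreeGroup.mk L) 1 else 0
  | (j, false) :: L =>
      foxWord k i L - if i = j then single (FreeGroup.mk ((j, false) :: L)) 1 else 0

/-- The Fox derivative `∂_i : Λ → Λ`, characterised by `w = ε(w) + ∑ x_i ∂_i w`. -/
def fox (k : Type*) [CommRing k] {n : ℕ} (i : Fin n) : FreePoly k n →ₗ[k] FreePoly k n :=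
  (MonoidAlgebra.basis (FreeGroup (Fin n)) k).constr k fun w => foxWord k i w.toWord

theorem fox_single (i : Fin n) (w : FreeGroup (Fin n)) :
    fox k i (single w 1) = foxWord k i w.toWord := by
  rw [← MonoidAlgebra.basis_apply, fox, Module.Basis.constr_basis]

theorem linearMap_ext {M : Type*} [AddCommGroup M] [Module k M] {f g : FreePoly k n →ₗ[k] M}
    (h : ∀ w, f (single w 1) = g (single w 1)) : f = g :=
  (MonoidAlgebra.basis (FreeGroup (Fin n)) k).ext fun w => by
    simpa only [MonoidAlgebra.basis_apply] using h w

theorem augmentation_single (w : FreeGroup (Fin n)) :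
    augmentation (single w 1 : FreePoly k n) = 1 := by
  simp [augmentation]

theorem augmentation_x (i : Fin n) : augmentation (x k i) = 0 := by
  simp [augmentation, x]

theorem x_mul (i : Fin n) (z : FreePoly k n) :
    x k i * z = single (FreeGroup.of i) 1 * z - z := by
  rw [x, sub_mul, one_mul, MonoidAlgebra.of_apply]

theorem fox_of_mul (i j : Fin n) (w : FreeGroup (Fin n)) :
    fox k i (single (FreeGroup.of j * w) 1) =
      fox k i (single w 1) + if i = j then single w 1 else 0 := by
  rw [fox_single, fox_single]
  have h : (FreeGroup.of j * w).toWord = FreeGroup.reduce ((j, true) :: w.toWord) := by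
    rw [FreeGroup.toWord_mul, FreeGroup.toWord_of, List.singleton_append]
  rw [h, FreeGroup.reduce.cons, FreeGroup.reduce_toWord]
  have hw : FreeGroup.mk w.toWord = w := FreeGroup.mk_toWord
  rcases hL : w.toWord with _ | ⟨⟨j', b⟩, L⟩
  · rw [hL] at hw
    simp [foxWord, ← hw]
  · rw [hL] at hw
    by_cases hc : j = j' ∧ b = false
    -- When `t_j` cancels the first letter of `w`, the word `w` itself is the negative term of
    -- `foxWord`, and the added `w` removes it.
    · obtain ⟨rfl, rfl⟩ := hc
      simp [foxWord, ← hw]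
    · have : ¬ (j = j' ∧ true = !b) := by
        simpa using hc
      simp only [this, if_false]
      simp only [foxWord, hw]

theorem fox_x_mul (i j : Fin n) (z : FreePoly k n) :
    fox k i (x k j * z) = if i = j then z else 0 := by
  have : (fox k i) ∘ₗ LinearMap.mulLeft k (x k j) =
      if i = j then LinearMap.id else 0 := by
    refine linearMap_ext fun w => ?_
    rw [LinearMap.comp_apply, LinearMap.mulLeft_apply, x_mul, MonoidAlgebra.single_mul_single,
      map_sub, one_mul, fox_of_mul]
    split_ifs <;> simp
  have h := LinearMap.congr_fun this z
  rw [LinearMap.comp_apply, LinearMap.mulLeft_apply] at h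
  rw [h]
  split_ifs <;> simp

theorem fox_sum_x_mul (i : Fin n) (c : Fin n → FreePoly k n) :
    fox k i (∑ j, x k j * c j) = c i := by
  simp [map_sum, fox_x_mul]

theorem foxWord_spec (L : List (Fin n × Bool)) :
    (single (FreeGroup.mk L) 1 : FreePoly k n) = 1 + ∑ i, x k i * foxWord k i L := by
  induction L with
  | nil => simp [foxWord, MonoidAlgebra.one_def, ← FreeGroup.one_eq_mk]
  | cons s L ih =>
    obtain ⟨j, b⟩ := s
    cases b
    · have h : FreeGroup.of j * FreeGroup.mk ((j, false) :: L) = FreeGroup.mk L := by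
        have : FreeGroup.mk ((j, false) :: L) = (FreeGroup.of j)⁻¹ * FreeGroup.mk L := by
          simp [FreeGroup.of, FreeGroup.inv_mk, FreeGroup.mul_mk, FreeGroup.invRev]
        rw [this, mul_inv_cancel_left]
      simp only [foxWord, mul_sub, Finset.sum_sub_distrib, mul_ite, mul_zero,
        Finset.sum_ite_eq', Finset.mem_univ, if_true]
      rw [x_mul, MonoidAlgebra.single_mul_single, h, one_mul, ih]
      abel
    · have h : FreeGroup.mk ((j, true) :: L) = FreeGroup.of j * FreeGroup.mk L := by
        simp [FreeGroup.of, FreeGroup.mul_mk]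
      simp only [foxWord, mul_add, Finset.sum_add_distrib, mul_ite, mul_zero,
        Finset.sum_ite_eq', Finset.mem_univ, if_true]
      rw [x_mul, MonoidAlgebra.single_mul_single, h, ← add_assoc, ← ih, one_mul]
      abel

theorem eq_augmentation_add_sum_fox (z : FreePoly k n) :
    z = algebraMap k _ (augmentation z) + ∑ i, x k i * fox k i z := by
  have : LinearMap.id = (Algebra.linearMap k (FreePoly k n)) ∘ₗ augmentation.toLinearMap +
      ∑ i, LinearMap.mulLeft k (x k i) ∘ₗ fox k i := by
    refine linearMap_ext fun w => ?_
    have h := foxWord_spec (k := k) w.toWord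
    rw [FreeGroup.mk_toWord] at h
    simp only [LinearMap.add_apply, LinearMap.comp_apply, LinearMap.sum_apply,
      LinearMap.mulLeft_apply, fox_single, AlgHom.toLinearMap_apply, augmentation_single,
      Algebra.linearMap_apply, map_one]
    exact h
  simpa using LinearMap.congr_fun this z

/-! ### Splitting along letters. -/

/-- The inverse of a letter. -/
def letterInv (s : Fin n × Bool) : Fin n × Bool := (s.1, !s.2)

theorem letterInv_letterInv (s : Fin n × Bool) : letterInv (letterInv s) = s := by
  simp [letterInv]

theorem letterInv_ne (s : Fin n × Bool) : letterInv s ≠ s := by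
  obtain ⟨i, b⟩ := s
  cases b <;> simp [letterInv]

/-- The part of `z` flowing through the letter `s`: to leading order, the sum of the terms of `z`
whose word starts with `s`. -/
def letterPart (k : Type*) [CommRing k] {n : ℕ} (s : Fin n × Bool) :
    FreePoly k n →ₗ[k] FreePoly k n :=
  if s.2 then LinearMap.mulLeft k (single (FreeGroup.of s.1) 1) ∘ₗ fox k s.1 else -fox k s.1

theorem letterPart_true (i : Fin n) (z : FreePoly k n) :
    letterPart k (i, true) z = single (FreeGroup.of i) 1 * fox k i z := by
  simp [letterPart]

theorem letterPart_false (i : Fin n) (z : FreePoly k n) :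
    letterPart k (i, false) z = -fox k i z := by
  simp [letterPart]

theorem eq_augmentation_add_sum_letterPart (z : FreePoly k n) :
    z = algebraMap k _ (augmentation z) + ∑ s, letterPart k s z := by
  conv_lhs => rw [eq_augmentation_add_sum_fox z]
  rw [Fintype.sum_prod_type]
  congr 1
  refine Finset.sum_congr rfl fun i _ => ?_
  rw [Fintype.sum_bool, letterPart_true, letterPart_false, x_mul]
  abel

/-- Both parts are `∂_i z` up to a unit, so a left ideal contains one as soon as it contains the
other. -/
theorem letterPart_eq_mul_letterInv (s : Fin n × Bool) (z : FreePoly k n) :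
    ∃ g : FreePoly k n, letterPart k s z = g * letterPart k (letterInv s) z := by
  obtain ⟨i, b⟩ := s
  cases b
  · refine ⟨-single (FreeGroup.of i)⁻¹ 1, ?_⟩
    rw [letterInv, Bool.not_false, letterPart_true, letterPart_false, neg_mul, ← mul_assoc,
      MonoidAlgebra.single_mul_single, inv_mul_cancel, one_mul, ← MonoidAlgebra.one_def, one_mul]
  · refine ⟨-single (FreeGroup.of i) 1, ?_⟩
    rw [letterInv, Bool.not_true, letterPart_true, letterPart_false, neg_mul_neg]

/-! ### The length filtration and the leading behaviour of letter parts. -/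

/-- The free polynomials all of whose words have length less than `l`. -/
def ball (k : Type*) [CommRing k] (n l : ℕ) : Submodule k (FreePoly k n) :=
  MonoidAlgebra.supported k k {w : FreeGroup (Fin n) | w.norm < l}

theorem mem_ball {l : ℕ} {z : FreePoly k n} :
    z ∈ ball k n l ↔ ∀ w ∈ z.coeff.support, FreeGroup.norm w < l :=
  MonoidAlgebra.mem_supported

theorem mem_ball_succ {l : ℕ} {z : FreePoly k n} : z ∈ ball k n (l + 1) ↔ z.length ≤ l := by
  rw [mem_ball, length, Finset.sup_le_iff]
  simp

theorem ball_zero {z : FreePoly k n} (h : z ∈ ball k n 0) : z = 0 := by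
  rw [mem_ball] at h
  refine MonoidAlgebra.coeff_eq_zero.1 (Finsupp.support_eq_empty.1 ?_)
  exact Finset.eq_empty_of_forall_notMem fun w hw => Nat.not_lt_zero _ (h w hw)

theorem ball_mono {l l' : ℕ} (h : l ≤ l') : ball k n l ≤ ball k n l' :=
  MonoidAlgebra.supported_mono fun _ hw => lt_of_lt_of_le hw h

theorem single_mem_ball {l : ℕ} {w : FreeGroup (Fin n)} (h : w.norm < l) :
    (single w 1 : FreePoly k n) ∈ ball k n l := by
  rw [ball, MonoidAlgebra.supported_eq_span_single]
  exact Submodule.subset_span ⟨w, h, rfl⟩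

theorem map_mem_of_mem_ball {M : Type*} [AddCommGroup M] [Module k M] {l : ℕ}
    (f : FreePoly k n →ₗ[k] M) {N : Submodule k M}
    (h : ∀ w : FreeGroup (Fin n), w.norm < l → f (single w 1) ∈ N) {z : FreePoly k n}
    (hz : z ∈ ball k n l) : f z ∈ N := by
  have : ball k n l ≤ N.comap f := by
    rw [ball, MonoidAlgebra.supported_eq_span_single, Submodule.span_le]
    rintro _ ⟨w, hw, rfl⟩
    exact h w hw
  exact this hz

/-- `letterPart` on a (not necessarily reduced) word. -/
def letterWord (k : Type*) [CommRing k] {n : ℕ} (s : Fin n × Bool) (L : List (Fin n × Bool)) :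
    FreePoly k n :=
  if s.2 then single (FreeGroup.of s.1) 1 * foxWord k s.1 L else -foxWord k s.1 L

theorem letterPart_single (s : Fin n × Bool) (w : FreeGroup (Fin n)) :
    letterPart k s (single w 1) = letterWord k s w.toWord := by
  obtain ⟨i, b⟩ := s
  cases b
  · rw [letterPart_false, fox_single, letterWord, if_neg (by simp)]
  · rw [letterPart_true, fox_single, letterWord, if_pos rfl]

theorem letterWord_cons (s s' : Fin n × Bool) (L : List (Fin n × Bool)) :
    letterWord k s (s' :: L) = letterWord k s L
      + (if s' = s then single (FreeGroup.mk (s' :: L)) 1 else 0)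
      - (if s' = letterInv s then single (FreeGroup.mk L) 1 else 0) := by
  obtain ⟨i, b⟩ := s
  obtain ⟨j, b'⟩ := s'
  have h1 : FreeGroup.of i * FreeGroup.mk L = FreeGroup.mk ((i, true) :: L) := by
    simp [FreeGroup.of, FreeGroup.mul_mk]
  have h2 : FreeGroup.of i * FreeGroup.mk ((i, false) :: L) = FreeGroup.mk L := by
    have : FreeGroup.mk ((i, false) :: L) = (FreeGroup.of i)⁻¹ * FreeGroup.mk L := by
      simp [FreeGroup.of, FreeGroup.inv_mk, FreeGroup.mul_mk, FreeGroup.invRev]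
    rw [this, mul_inv_cancel_left]
  rcases eq_or_ne i j with rfl | hij
  · cases b <;> cases b' <;>
      simp [letterWord, letterInv, foxWord, mul_add, mul_sub, MonoidAlgebra.single_mul_single,
        h1, h2] <;> abel
  · cases b <;> cases b' <;>
      simp [letterWord, letterInv, foxWord, hij, hij.symm]

theorem letterWord_mem_ball (s : Fin n × Bool) (L : List (Fin n × Bool)) :
    letterWord k s L ∈ ball k n (L.length + 1) := by
  induction L with
  | nil =>
    have : letterWord k s [] = 0 := by simp [letterWord, foxWord]
    rw [this]
    exact zero_mem _
  | cons s' L ih =>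
    rw [letterWord_cons]
    refine sub_mem (add_mem (ball_mono (by simp) ih) ?_) ?_
    · split_ifs
      · exact single_mem_ball (Nat.lt_succ_of_le FreeGroup.norm_mk_le)
      · exact zero_mem _
    · split_ifs
      · exact single_mem_ball (FreeGroup.norm_mk_le.trans_lt (by simp))
      · exact zero_mem _

/-- In the signed sum of suffixes only the first letter of `w` can contribute `w` itself; all other
terms are shorter. The next lemmas deduce that letter parts are orthogonal idempotents modulo
shorter words. -/
theorem letterPart_single_sub_mem_ball (s : Fin n × Bool) (w : FreeGroup (Fin n)) :
    letterPart k s (single w 1) - (if w.toWord.head? = some s then single w 1 else 0) ∈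
      ball k n w.norm := by
  rw [letterPart_single, FreeGroup.norm]
  have hw : FreeGroup.mk w.toWord = w := FreeGroup.mk_toWord
  rcases hL : w.toWord with _ | ⟨s', L⟩
  · simp [letterWord, foxWord]
  · rw [hL] at hw
    have : letterWord k s (s' :: L) -
        (if (s' :: L).head? = some s then single w 1 else 0) =
        letterWord k s L - (if s' = letterInv s then single (FreeGroup.mk L) 1 else 0) := by
      rw [letterWord_cons, hw]
      simp only [List.head?_cons, Option.some_inj]
      abel
    rw [this, List.length_cons]
    refine sub_mem (letterWord_mem_ball s L) ?_
    split_ifs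
    · exact single_mem_ball (Nat.lt_succ_of_le FreeGroup.norm_mk_le)
    · exact zero_mem _

theorem letterPart_mem_ball (s : Fin n × Bool) {l : ℕ} {z : FreePoly k n} (hz : z ∈ ball k n l) :
    letterPart k s z ∈ ball k n l := by
  refine map_mem_of_mem_ball _ (fun w hw => ?_) hz
  rw [letterPart_single]
  exact ball_mono hw (letterWord_mem_ball s w.toWord)

theorem letterPart_letterPart_self_sub_mem_ball (s : Fin n × Bool) {l : ℕ} {z : FreePoly k n}
    (hz : z ∈ ball k n (l + 1)) :
    letterPart k s (letterPart k s z) - letterPart k s z ∈ ball k n l := by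
  refine map_mem_of_mem_ball (letterPart k s ∘ₗ letterPart k s - letterPart k s)
    (fun w hw => ?_) hz
  rw [LinearMap.sub_apply, LinearMap.comp_apply, ← map_sub]
  have h := ball_mono (Nat.le_of_lt_succ hw) (letterPart_single_sub_mem_ball (k := k) s w)
  split_ifs at h
  · exact letterPart_mem_ball s h
  · rw [sub_zero] at h
    rw [map_sub]
    exact sub_mem (letterPart_mem_ball s h) h

theorem letterPart_letterPart_mem_ball {r s : Fin n × Bool} (hrs : r ≠ s) {l : ℕ}
    {z : FreePoly k n} (hz : z ∈ ball k n (l + 1)) :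
    letterPart k r (letterPart k s z) ∈ ball k n l := by
  refine map_mem_of_mem_ball (letterPart k r ∘ₗ letterPart k s) (fun w hw => ?_) hz
  rw [LinearMap.comp_apply]
  have hr := ball_mono (Nat.le_of_lt_succ hw) (letterPart_single_sub_mem_ball (k := k) r w)
  have hs := ball_mono (Nat.le_of_lt_succ hw) (letterPart_single_sub_mem_ball (k := k) s w)
  split_ifs at hs with h
  · rw [h, if_neg (by simpa using hrs.symm), sub_zero] at hr
    rw [← sub_add_cancel (letterPart k s (single w 1)) (single w 1), map_add]
    exact add_mem (letterPart_mem_ball r hs) hr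
  · rw [sub_zero] at hs
    exact letterPart_mem_ball r hs

/-! ### Fox closed left ideals. -/

/-- A left ideal `J` of `Λ` is Fox closed if it contains the Fox derivatives of all its elements
of augmentation zero. -/
def IsFoxClosed (J : Ideal (FreePoly k n)) : Prop :=
  ∀ z ∈ J, augmentation z = 0 → ∀ i, fox k i z ∈ J

theorem IsFoxClosed.letterPart_mem {J : Ideal (FreePoly k n)} (hJ : IsFoxClosed J)
    {z : FreePoly k n} (hz : z ∈ J) (h0 : augmentation z = 0) (s : Fin n × Bool) :
    letterPart k s z ∈ J := by
  obtain ⟨i, b⟩ := s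
  cases b
  · rw [letterPart_false]
    exact neg_mem (hJ z hz h0 i)
  · rw [letterPart_true]
    exact J.mul_mem_left _ (hJ z hz h0 i)

theorem augmentation_smul (c : k) (z : FreePoly k n) :
    augmentation (c • z) = c * augmentation z := by
  rw [map_smul, smul_eq_mul]

theorem augmentation_sub_smul {d : FreePoly k n} (hd : augmentation d = 1) (z : FreePoly k n) :
    augmentation (z - augmentation z • d) = 0 := by
  rw [map_sub, augmentation_smul, hd, mul_one, sub_self]

theorem smul_mem_ideal {J : Ideal (FreePoly k n)} (c : k) {z : FreePoly k n} (hz : z ∈ J) :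
    c • z ∈ J :=
  J.smul_of_tower_mem c hz

theorem eq_sum_letterPart {z : FreePoly k n} (h0 : augmentation z = 0) :
    z = ∑ s, letterPart k s z := by
  conv_lhs => rw [eq_augmentation_add_sum_letterPart z, h0, map_zero, zero_add]

theorem letterPart_mem_of_letterInv {J : Ideal (FreePoly k n)} {z : FreePoly k n}
    {s : Fin n × Bool} (h : letterPart k (letterInv s) z ∈ J) : letterPart k s z ∈ J := by
  obtain ⟨g, hg⟩ := letterPart_eq_mul_letterInv s z
  rw [hg]
  exact J.mul_mem_left _ h

theorem letterPart_eq_zero_of_letterInv {z : FreePoly k n} {s : Fin n × Bool}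
    (h : letterPart k (letterInv s) z = 0) : letterPart k s z = 0 := by
  obtain ⟨g, hg⟩ := letterPart_eq_mul_letterInv s z
  rw [hg, h, mul_zero]

/-- Minimality turns approximate identities into exact ones: `z` equals its own `s`-part, hence its
`s⁻¹`-part is short and vanishes, and then so does the `s`-part. Thus, at minimal length, a nonzero
element led by a single letter has nonzero augmentation. -/
theorem IsFoxClosed.eq_zero_of_letterPart_sub_mem {J : Ideal (FreePoly k n)} (hJ : IsFoxClosed J)
    {m : ℕ} (hm : ∀ z ∈ J, z ∈ ball k n m → z = 0) {z : FreePoly k n} (hz : z ∈ J)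
    (hzm : z ∈ ball k n (m + 1)) (h0 : augmentation z = 0) (s : Fin n × Bool)
    (hs : letterPart k s z - z ∈ ball k n m) : z = 0 := by
  have hzs : letterPart k s z = z :=
    sub_eq_zero.1 (hm _ (sub_mem (hJ.letterPart_mem hz h0 s) hz) hs)
  have h1 : letterPart k (letterInv s) z = 0 := by
    refine hm _ (hJ.letterPart_mem hz h0 _) ?_
    have := letterPart_letterPart_mem_ball (letterInv_ne s) hzm
    rwa [hzs] at this
  rw [← hzs]
  exact letterPart_eq_zero_of_letterInv h1

end CommRing

/-! ### Principality of Fox closed left ideals over a field. -/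

variable {k : Type*} [Field k] {n : ℕ}

/-- Base case of the division argument: the elements of `J` of minimal length are already multiples
of one comonic element. -/
theorem IsFoxClosed.exists_comonic_of_minimal {J : Ideal (FreePoly k n)} (hJ : IsFoxClosed J)
    {m : ℕ} (hm : ∀ z ∈ J, z ∈ ball k n m → z = 0) {z : FreePoly k n} (hz : z ∈ J)
    (hzm : z ∈ ball k n (m + 1)) (hz0 : z ≠ 0) :
    ∃ d ∈ J, d ∈ ball k n (m + 1) ∧ augmentation d = 1 ∧
      ∀ w ∈ J, w ∈ ball k n (m + 1) → w ∈ Ideal.span {d} := by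
  have key : ∀ d ∈ J, augmentation d = 1 → d ∈ ball k n (m + 1) →
      (∀ w ∈ J, w ∈ ball k n (m + 1) → augmentation w = 0 → w ∈ Ideal.span {d}) →
      ∀ w ∈ J, w ∈ ball k n (m + 1) → w ∈ Ideal.span {d} := by
    intro d hd hd1 hdm H w hw hwm
    have hdd : augmentation w • d ∈ Ideal.span {d} :=
      smul_mem_ideal _ (Ideal.mem_span_singleton_self d)
    rw [← sub_add_cancel w (augmentation w • d)]
    refine add_mem (H _ (sub_mem hw (smul_mem_ideal _ hd))
      (sub_mem hwm (Submodule.smul_mem _ _ hdm)) (augmentation_sub_smul hd1 w)) hdd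
  -- Either augmentation is injective on the minimal layer, which is then the line through `z`, or
  -- some nonzero `y` there has augmentation zero; a normalised nonzero letter part of `y` then
  -- serves as `d`.
  by_cases hV : ∀ w ∈ J, w ∈ ball k n (m + 1) → augmentation w = 0 → w = 0
  · have hε : augmentation z ≠ 0 := fun h => hz0 (hV z hz hzm h)
    have hd : (augmentation z)⁻¹ • z ∈ J := smul_mem_ideal _ hz
    have hdm : (augmentation z)⁻¹ • z ∈ ball k n (m + 1) := Submodule.smul_mem _ _ hzm
    have hd1 : augmentation ((augmentation z)⁻¹ • z) = 1 := by
      rw [augmentation_smul, inv_mul_cancel₀ hε]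
    refine ⟨_, hd, hdm, hd1, key _ hd hd1 hdm fun w hw hwm h0 => ?_⟩
    rw [hV w hw hwm h0]
    exact zero_mem _
  · push Not at hV
    obtain ⟨y, hy, hym, hy0, hyne⟩ := hV
    obtain ⟨s, hs⟩ : ∃ s, letterPart k s y ≠ 0 := by
      by_contra! h
      exact hyne (by rw [eq_sum_letterPart hy0, Finset.sum_eq_zero fun s _ => h s])
    have hsJ : letterPart k s y ∈ J := hJ.letterPart_mem hy hy0 s
    have hsm : letterPart k s y ∈ ball k n (m + 1) := letterPart_mem_ball s hym
    have hε : augmentation (letterPart k s y) ≠ 0 := fun h =>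
      hs (hJ.eq_zero_of_letterPart_sub_mem hm hsJ hsm h s
        (letterPart_letterPart_self_sub_mem_ball s hym))
    obtain ⟨d, hdef⟩ : ∃ d, d = (augmentation (letterPart k s y))⁻¹ • letterPart k s y := ⟨_, rfl⟩
    have hd : d ∈ J := hdef ▸ smul_mem_ideal _ hsJ
    have hdm : d ∈ ball k n (m + 1) := hdef ▸ Submodule.smul_mem _ _ hsm
    have hd1 : augmentation d = 1 := by
      rw [hdef, augmentation_smul, inv_mul_cancel₀ hε]
    have hds : letterPart k s d - d ∈ ball k n m := by
      rw [hdef, map_smul, ← smul_sub]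
      exact Submodule.smul_mem _ _ (letterPart_letterPart_self_sub_mem_ball s hym)
    have hdr : ∀ r, r ≠ s → letterPart k r d ∈ ball k n m := by
      intro r hr
      rw [hdef, map_smul]
      exact Submodule.smul_mem _ _ (letterPart_letterPart_mem_ball hr hym)
    have hdm0 : d ∉ ball k n m := by
      intro h
      have := hm d hd h
      rw [this, map_zero] at hd1
      exact zero_ne_one hd1
    refine ⟨d, hd, hdm, hd1, key d hd hd1 hdm fun w hw hwm h0 => ?_⟩
    have hself : letterPart k s w ∈ Ideal.span {d} := by
      have hηJ := hJ.letterPart_mem hw h0 s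
      have hηm := letterPart_mem_ball s hwm
      have hzero : letterPart k s w - augmentation (letterPart k s w) • d = 0 := by
        refine hJ.eq_zero_of_letterPart_sub_mem hm (sub_mem hηJ (smul_mem_ideal _ hd))
          (sub_mem hηm (Submodule.smul_mem _ _ hdm)) (augmentation_sub_smul hd1 _) s ?_
        rw [map_sub, map_smul, sub_sub_sub_comm, ← smul_sub]
        exact sub_mem (letterPart_letterPart_self_sub_mem_ball s hwm)
          (Submodule.smul_mem _ _ hds)
      rw [sub_eq_zero.1 hzero]
      exact smul_mem_ideal _ (Ideal.mem_span_singleton_self d)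
    rw [eq_sum_letterPart h0]
    refine sum_mem fun r _ => ?_
    by_cases hrs : r = s
    · rw [hrs]
      exact hself
    by_cases hrs' : r = letterInv s
    · refine letterPart_mem_of_letterInv ?_
      rw [hrs', letterInv_letterInv]
      exact hself
    -- For the other letters `r`, set `ξ = η - c d` with `η` the `r`-part of `w` and `c = ε(η)`. Its
    -- `s⁻¹`-part is short, hence zero, so its `s`-part is zero too. As `d` is led by `s` and `η` by
    -- `r`, this makes `c d` short, forcing `c = 0` and then `η = 0`.
    have hrs'' : letterInv s ≠ r := Ne.symm hrs'
    have hηJ := hJ.letterPart_mem hw h0 r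
    have hηm := letterPart_mem_ball r hwm
    generalize hc : augmentation (letterPart k r w) = c
    have hξJ : letterPart k r w - c • d ∈ J := sub_mem hηJ (smul_mem_ideal _ hd)
    have hξ0 : augmentation (letterPart k r w - c • d) = 0 := hc ▸ augmentation_sub_smul hd1 _
    have hξinv : letterPart k (letterInv s) (letterPart k r w - c • d) = 0 := by
      refine hm _ (hJ.letterPart_mem hξJ hξ0 _) ?_
      rw [map_sub, map_smul]
      exact sub_mem (letterPart_letterPart_mem_ball hrs'' hwm)
        (Submodule.smul_mem _ _ (hdr _ (letterInv_ne s)))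
    have hξs := letterPart_eq_zero_of_letterInv hξinv
    have hcd : c • d ∈ ball k n m := by
      rw [map_sub, map_smul, sub_eq_zero] at hξs
      have h1 : c • letterPart k s d ∈ ball k n m :=
        hξs ▸ letterPart_letterPart_mem_ball (Ne.symm hrs) hwm
      have h2 := sub_mem h1 (Submodule.smul_mem (ball k n m) c hds)
      rwa [← smul_sub, sub_sub_cancel] at h2
    have hc0 : c = 0 := by
      by_contra hne
      exact hdm0 ((Submodule.smul_mem_iff _ hne).1 hcd)
    rw [hc0] at hc
    have : letterPart k r w = 0 :=
      hJ.eq_zero_of_letterPart_sub_mem hm hηJ hηm hc r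
        (letterPart_letterPart_self_sub_mem_ball r hwm)
    rw [this]
    exact zero_mem _

/-- A nonzero Fox closed left ideal of `Λ` is generated by a comonic element of minimal length. -/
theorem IsFoxClosed.exists_generator {J : Ideal (FreePoly k n)} (hJ : IsFoxClosed J)
    (hJ0 : J ≠ ⊥) :
    ∃ d : FreePoly k n, d.IsComonic ∧ J = Ideal.span {d} ∧
      ∀ z ∈ J, z ≠ 0 → d.length ≤ z.length := by
  classical
  have hex : ∃ m, ∃ z ∈ J, z ∈ ball k n (m + 1) ∧ z ≠ 0 := by
    obtain ⟨z, hz, hz0⟩ := Submodule.exists_mem_ne_zero_of_ne_bot hJ0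
    exact ⟨z.length, z, hz, mem_ball_succ.2 le_rfl, hz0⟩
  obtain ⟨m, ⟨z, hz, hzm, hz0⟩, hmin⟩ : ∃ m, (∃ z ∈ J, z ∈ ball k n (m + 1) ∧ z ≠ 0) ∧
      ∀ l < m, ¬ ∃ z ∈ J, z ∈ ball k n (l + 1) ∧ z ≠ 0 :=
    ⟨Nat.find hex, Nat.find_spec hex, fun l hl => Nat.find_min hex hl⟩
  have hm : ∀ z ∈ J, z ∈ ball k n m → z = 0 := by
    intro z hz hzm
    cases m with
    | zero => exact ball_zero hzm
    | succ l =>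
      by_contra hne
      exact hmin l l.lt_succ_self ⟨z, hz, hzm, hne⟩
  obtain ⟨d, hd, hdm, hd1, hgen⟩ := hJ.exists_comonic_of_minimal hm hz hzm hz0
  -- Induction on length: correct each letter part of `γ` by a multiple of `d` to get `ξ` of
  -- augmentation zero. Its `s⁻¹`-part is shorter, so lies in `Λ d`; hence so does its `s`-part,
  -- which differs from `ξ` by a shorter element of `J`.
  have hall : ∀ l, m + 1 ≤ l → ∀ w ∈ J, w ∈ ball k n l → w ∈ Ideal.span {d} := by
    intro l hl
    induction l, hl using Nat.le_induction with
    | base => exact hgen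
    | succ l hl ih =>
      intro w hw hwl
      have hdl : d ∈ ball k n l := ball_mono hl hdm
      have hdl' : d ∈ ball k n (l + 1) := ball_mono l.le_succ hdl
      have hspan : ∀ c : k, c • d ∈ Ideal.span {d} := fun c =>
        smul_mem_ideal c (Ideal.mem_span_singleton_self d)
      rw [← sub_add_cancel w (augmentation w • d)]
      refine add_mem ?_ (hspan _)
      have hγJ : w - augmentation w • d ∈ J := sub_mem hw (smul_mem_ideal _ hd)
      have hγl : w - augmentation w • d ∈ ball k n (l + 1) :=
        sub_mem hwl (Submodule.smul_mem _ _ hdl')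
      have hγ0 := augmentation_sub_smul hd1 w
      generalize w - augmentation w • d = γ at hγJ hγl hγ0
      rw [eq_sum_letterPart hγ0]
      refine sum_mem fun s _ => ?_
      have hηJ := hJ.letterPart_mem hγJ hγ0 s
      have hξ0 := augmentation_sub_smul hd1 (letterPart k s γ)
      generalize augmentation (letterPart k s γ) = c at hξ0
      have hξJ : letterPart k s γ - c • d ∈ J := sub_mem hηJ (smul_mem_ideal _ hd)
      have hinv : letterPart k (letterInv s) (letterPart k s γ - c • d) ∈ Ideal.span {d} := by
        refine ih _ (hJ.letterPart_mem hξJ hξ0 _) ?_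
        rw [map_sub, map_smul]
        exact sub_mem (letterPart_letterPart_mem_ball (letterInv_ne s) hγl)
          (Submodule.smul_mem _ _ (letterPart_mem_ball _ hdl))
      have hs := letterPart_mem_of_letterInv hinv
      have hdiff : letterPart k s (letterPart k s γ - c • d) - (letterPart k s γ - c • d) ∈
          Ideal.span {d} := by
        refine ih _ (sub_mem (hJ.letterPart_mem hξJ hξ0 _) hξJ) ?_
        rw [map_sub, map_smul, sub_sub_sub_comm, ← smul_sub]
        exact sub_mem (letterPart_letterPart_self_sub_mem_ball s hγl)
          (Submodule.smul_mem _ _ (sub_mem (letterPart_mem_ball s hdl) hdl))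
      have := add_mem (sub_mem hs hdiff) (hspan c)
      rwa [sub_sub_cancel, sub_add_cancel] at this
  refine ⟨d, hd1, le_antisymm (fun w hw => ?_) ?_, fun w hw hw0 => ?_⟩
  · exact hall (max m w.length + 1) (by omega) w hw (mem_ball_succ.2 (le_max_right _ _))
  · rw [Ideal.span_le, Set.singleton_subset_iff]
    exact hd
  · refine (mem_ball_succ.1 hdm).trans (not_lt.1 fun hlt => ?_)
    exact hmin _ hlt ⟨w, hw, mem_ball_succ.2 le_rfl, hw0⟩

/-- Comonic free polynomials are right cancellable. -/
theorem IsComonic.eq_zero_of_mul_eq_zero {d : FreePoly k n} (hd : d.IsComonic)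
    {y : FreePoly k n} (h : y * d = 0) : y = 0 := by
  -- The left annihilator of `d` is Fox closed. If nonzero it would contain a comonic element, but
  -- `ε(z d) = ε(z)` puts it inside the augmentation ideal.
  let K : Ideal (FreePoly k n) := LinearMap.ker (LinearMap.toSpanSingleton (FreePoly k n) _ d)
  have hK : ∀ z, z ∈ K ↔ z * d = 0 := fun z => by
    simp [K, LinearMap.mem_ker]
  have hε : ∀ z ∈ K, augmentation z = 0 := by
    intro z hz
    have := congrArg augmentation ((hK z).1 hz)
    rw [map_mul, show augmentation d = 1 from hd, mul_one, map_zero] at this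
    exact this
  have hclosed : IsFoxClosed K := by
    intro z hz h0 i
    rw [hK] at hz ⊢
    have h1 := eq_augmentation_add_sum_fox z
    rw [h0, map_zero, zero_add] at h1
    rw [h1, Finset.sum_mul] at hz
    simp only [mul_assoc] at hz
    rw [← fox_sum_x_mul i (fun j => fox k j z * d), hz, map_zero]
  by_contra hy
  obtain ⟨e, he, hKe, -⟩ := hclosed.exists_generator
    (fun h' => hy (by rwa [← hK, h', Submodule.mem_bot] at h))
  have := hε e (hKe ▸ Ideal.mem_span_singleton_self e)
  rw [show augmentation e = 1 from he] at this
  exact one_ne_zero this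

end FreePoly

/-! ### Traces on `Λ` of left ideals of the Fox algebra. -/

namespace FoxAlgebra

open FreePoly

section CommRing

variable {k : Type*} [CommRing k] {n : ℕ}

/-- The trace on `Λ` of a left ideal of the Fox algebra is Fox closed. -/
theorem isFoxClosed_comap (I : Ideal (FoxAlgebra k n)) :
    IsFoxClosed (I.comap (incl k n).toRingHom) := by
  intro z hz h0 i
  have h : xStar k i * incl k n z = incl k n (fox k i z) := by
    conv_lhs => rw [eq_augmentation_add_sum_fox z, h0, map_zero, zero_add]
    simp [map_sum, Finset.mul_sum, ← mul_assoc, xStar_mul_incl_x]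
  change incl k n (fox k i z) ∈ I
  rw [← h]
  exact I.mul_mem_left _ hz

/-- For comonic `d`, the left ideal of the Fox algebra generated by `d` meets `Λ` in `Λ d`. -/
theorem mem_span_of_incl_mem_span {d z : FreePoly k n} (hd : d.IsComonic)
    (h : incl k n z ∈ Ideal.span {incl k n d}) : z ∈ Ideal.span {d} := by
  -- The module `Λ / Λ d` is extended to an `L(Λ)`-module by the universal property. There `d` kills
  -- the class of `1`, hence so does any `z` in `L(Λ) d`, which means `z ∈ Λ d`.
  let S : Submodule k (FreePoly k n) := (Ideal.span {d}).restrictScalars k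
  have hd1 : augmentation d = 1 := hd
  have hmul : ∀ a, S ≤ S.comap (LinearMap.mulLeft k a) := fun a w hw =>
    (Ideal.span {d}).mul_mem_left a hw
  let f : FreePoly k n →ₐ[k] Module.End k (FreePoly k n ⧸ S) :=
    { toFun a := S.mapQ S (LinearMap.mulLeft k a) (hmul a)
      map_one' := Submodule.linearMap_qext S (LinearMap.ext fun w => congrArg S.mkQ (one_mul w))
      map_mul' a b := Submodule.linearMap_qext S (LinearMap.ext fun w =>
        congrArg S.mkQ (mul_assoc a b w))
      map_zero' := Submodule.linearMap_qext S (LinearMap.ext fun w => congrArg S.mkQ (zero_mul w))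
      map_add' a b := Submodule.linearMap_qext S (LinearMap.ext fun w =>
        (congrArg S.mkQ (add_mul a b w)).trans (map_add S.mkQ _ _))
      commutes' c := Submodule.linearMap_qext S (LinearMap.ext fun w =>
        (congrArg S.mkQ (Algebra.smul_def c w).symm).trans (map_smul S.mkQ c w)) }
  have hf : ∀ a w, f a (S.mkQ w) = S.mkQ (a * w) := fun a w => rfl
  -- The action of `x_i^*`: since `d` is comonic, `w - ε(w) d` represents the class of `w` with
  -- augmentation zero, and on such elements `x_i^*` must be `∂_i`.
  let p : Fin n → FreePoly k n →ₗ[k] FreePoly k n := fun i =>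
    fox k i ∘ₗ (LinearMap.id - LinearMap.toSpanSingleton k _ d ∘ₗ augmentation.toLinearMap)
  have hp : ∀ i w, p i w = fox k i (w - augmentation w • d) := fun i w => rfl
  have hpS : ∀ i, S ≤ S.comap (p i) := by
    intro i w hw
    obtain ⟨v, rfl⟩ := Ideal.mem_span_singleton'.1 (show w ∈ Ideal.span {d} from hw)
    have : v * d - augmentation (v * d) • d = ∑ j, x k j * (fox k j v * d) := by
      rw [map_mul, hd1, mul_one]
      nth_rw 1 [eq_augmentation_add_sum_fox v]
      rw [add_mul, ← Algebra.smul_def, add_sub_cancel_left, Finset.sum_mul]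
      simp only [mul_assoc]
    change p i (v * d) ∈ Ideal.span {d}
    rw [hp, this, fox_sum_x_mul]
    exact Ideal.mem_span_singleton'.2 ⟨_, rfl⟩
  let y : Fin n → Module.End k (FreePoly k n ⧸ S) := fun i => S.mapQ S (p i) (hpS i)
  have hy : ∀ i w, y i (S.mkQ w) = S.mkQ (p i w) := fun i w => rfl
  obtain ⟨g, ⟨hg, -⟩, -⟩ := existsUnique_lift f y (by
    intro i j
    refine Submodule.linearMap_qext S (LinearMap.ext fun w => ?_)
    change y i (f (x k j) (S.mkQ w)) = _
    rw [hf, hy, hp, map_mul, augmentation_x, zero_mul, zero_smul, sub_zero, fox_x_mul]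
    split_ifs <;> simp) (by
    refine Submodule.linearMap_qext S (LinearMap.ext fun w => ?_)
    have : ∀ i, (f (x k i) * y i) (S.mkQ w) = S.mkQ (x k i * p i w) := fun i => rfl
    change (∑ i, f (x k i) * y i) (S.mkQ w) = S.mkQ w
    rw [LinearMap.sum_apply]
    simp only [this, hp]
    have h2 := eq_augmentation_add_sum_fox (w - augmentation w • d)
    rw [augmentation_sub_smul hd1, map_zero, zero_add] at h2
    rw [← map_sum, ← h2, map_sub, sub_eq_self, Submodule.mkQ_apply,
      Submodule.Quotient.mk_eq_zero]
    exact S.smul_mem _ (Ideal.mem_span_singleton_self d))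
  obtain ⟨q, hq⟩ := Ideal.mem_span_singleton'.1 h
  have hgf : ∀ a, g (incl k n a) = f a := fun a => DFunLike.congr_fun hg a
  have hz : f z (S.mkQ 1) = 0 := by
    rw [← hgf, ← hq, map_mul, hgf, Module.End.mul_apply, hf, mul_one]
    have : S.mkQ d = 0 := by
      rw [Submodule.mkQ_apply, Submodule.Quotient.mk_eq_zero]
      exact Ideal.mem_span_singleton_self d
    rw [this, map_zero]
  rw [hf, mul_one, Submodule.mkQ_apply, Submodule.Quotient.mk_eq_zero] at hz
  exact hz

end CommRing

end FoxAlgebra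

end

/-! ### Existence and uniqueness of the greatest common divisor. -/

theorem theoremf9 {k : Type*} [Field k] {n : ℕ} (a b : FreePoly k n) (hab : a ≠ 0 ∨ b ≠ 0) :
    ∃ d : FreePoly k n,
      IsFoxGCD a b d ∧
      (a ≠ 0 → d.length ≤ a.length) ∧ (b ≠ 0 → d.length ≤ b.length) ∧
      ∀ d' : FreePoly k n, IsFoxGCD a b d' ↔
        d'.IsComonic ∧ ∃ u : (FreePoly k n)ˣ, d' = (u : FreePoly k n) * d := by
  let I : Ideal (FoxAlgebra k n) :=
    Ideal.span {FoxAlgebra.incl k n a} ⊔ Ideal.span {FoxAlgebra.incl k n b}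
  let J : Ideal (FreePoly k n) := I.comap (FoxAlgebra.incl k n).toRingHom
  have hJmem : ∀ z, z ∈ J ↔ FoxAlgebra.incl k n z ∈ I := fun z => Iff.rfl
  have ha : a ∈ J := (le_sup_left : _ ≤ I) (Ideal.mem_span_singleton_self _)
  have hb : b ∈ J := (le_sup_right : _ ≤ I) (Ideal.mem_span_singleton_self _)
  have hJ0 : J ≠ ⊥ := by
    intro h
    rw [h, Submodule.mem_bot] at ha hb
    exact hab.elim (fun h => h ha) (fun h => h hb)
  have hincl : ∀ {z e : FreePoly k n}, z ∈ Ideal.span {e} →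
      FoxAlgebra.incl k n z ∈ Ideal.span {FoxAlgebra.incl k n e} := by
    intro z e hz
    obtain ⟨v, rfl⟩ := Ideal.mem_span_singleton'.1 hz
    exact Ideal.mem_span_singleton'.2 ⟨FoxAlgebra.incl k n v, (map_mul _ _ _).symm⟩
  obtain ⟨d, hd, hJd, hlen⟩ := (FoxAlgebra.isFoxClosed_comap I).exists_generator hJ0
  change J = _ at hJd
  have hId : I = Ideal.span {FoxAlgebra.incl k n d} := by
    refine le_antisymm (sup_le ?_ ?_) ?_
    · rw [Ideal.span_le, Set.singleton_subset_iff]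
      exact hincl (hJd ▸ ha)
    · rw [Ideal.span_le, Set.singleton_subset_iff]
      exact hincl (hJd ▸ hb)
    · rw [Ideal.span_le, Set.singleton_subset_iff]
      exact (hJmem d).1 (hJd ▸ Ideal.mem_span_singleton_self d)
  refine ⟨d, ⟨hd, hId⟩, hlen a ha, hlen b hb, fun d' => ⟨?_, ?_⟩⟩
  · rintro ⟨hd', hId'⟩
    change I = _ at hId'
    refine ⟨hd', ?_⟩
    obtain ⟨u, hu⟩ := Ideal.mem_span_singleton'.1 (FoxAlgebra.mem_span_of_incl_mem_span hd
      (show FoxAlgebra.incl k n d' ∈ Ideal.span {FoxAlgebra.incl k n d} by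
        rw [← hId, hId']
        exact Ideal.mem_span_singleton_self _))
    obtain ⟨v, hv⟩ := Ideal.mem_span_singleton'.1 (FoxAlgebra.mem_span_of_incl_mem_span hd'
      (show FoxAlgebra.incl k n d ∈ Ideal.span {FoxAlgebra.incl k n d'} by
        rw [← hId', hId]
        exact Ideal.mem_span_singleton_self _))
    have huv : u * v = 1 := by
      refine sub_eq_zero.1 (hd'.eq_zero_of_mul_eq_zero ?_)
      rw [sub_mul, mul_assoc, hv, hu, one_mul, sub_self]
    have hvu : v * u = 1 := by
      refine sub_eq_zero.1 (hd.eq_zero_of_mul_eq_zero ?_)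
      rw [sub_mul, mul_assoc, hu, hv, one_mul, sub_self]
    exact ⟨⟨u, v, huv, hvu⟩, hu.symm⟩
  · rintro ⟨hd', u, rfl⟩
    refine ⟨hd', hId.trans (le_antisymm ?_ ?_)⟩
    · rw [Ideal.span_le, Set.singleton_subset_iff]
      refine hincl (Ideal.mem_span_singleton'.2 ⟨((u⁻¹ : (FreePoly k n)ˣ) : FreePoly k n), ?_⟩)
      rw [Units.inv_mul_cancel_left]
    · rw [Ideal.span_le, Set.singleton_subset_iff]
      exact hincl (Ideal.mem_span_singleton'.2 ⟨u, rfl⟩)
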